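/- Let $n\ge 2$, $m\ge 1$, let $(\mathbb{R}^n,g_0)$ be the Euclidean space with coordinates $x=(x_1,\dots,x_n)$, and let $(F,g_F)$ be a nonempty $m$-dimensional smooth Riemannian manifold (without boundary) that is Einstein with constant Ricci curvature $\lambda_F\in\mathbb{R}$, i.e. $\mathrm{Ric}_{g_F}=\lambda_F\, g_F$. Let $f,h:\mathbb{R}^n\to\mathbb{R}$ be smooth functions with $f>0$, and let $M=\mathbb{R}^n\times_f F$ be the warped product, that is, the product manifold $\mathbb{R}^n\times F$ with the metric $g=g_0\oplus f^2 g_F$. Regard $h$ as a function on $M$ that depends only on the $\mathbb{R}^n$-component, and let $\rho\in\mathbb{R}$. Then $(M,g)$ is a gradient Ricci soliton with potential function $h$ and constant $\rho$, that is, $$\mathrm{Ric}_g+\mathrm{Hess}_g(h)=\rho\, g \quad\text{on } M,$$ if and only if $f$ and $h$ satisfy, at every point of $\mathbb{R}^n$, $$\begin{cases} f\,h_{,x_ix_j}-m\,f_{,x_ix_j}=0 & \text{for all } i\ne j,\\ f\,h_{,x_ix_i}-m\,f_{,x_ix_i}=\rho f & \text{for all } i,\\ \displaystyle\sum_{k=1}^{n}\left[-f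 f_{,x_kx_k}-(m-1)f_{,x_k}^2+f f_{,x_k}h_{,x_k}\right]=\rho f^2-\lambda_F, \end{cases}$$ where $f_{,x_k}$, $f_{,x_ix_j}$ and $h_{,x_k}$, $h_{,x_ix_j}$ denote the first and second partial derivatives of $f$ and $h$. -/

import Mathlib

set_option maxSynthPendingDepth 3

open scoped Manifold ContDiff Bundle

noncomputable section

namespace RicciSoliton

/-! ### Riemannian geometry of a metric tensor on (an open piece of) a vector space

Here `G : E → E →L[ℝ] E →L[ℝ] ℝ` is a metric tensor on a finite-dimensional space `E`, for instance
the expression of a Riemannian metric in a chart. All formulas are written without indices. -/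

section Coordinates

variable {E : Type*} [NormedAddCommGroup E] [NormedSpace ℝ E]

/-- The Christoffel symbols of the first kind:
`(u, v, w) ↦ ½ (∂_u G(v, w) + ∂_v G(u, w) - ∂_w G(u, v))`. -/
def christoffelFirst (G : E → E →L[ℝ] E →L[ℝ] ℝ) (y : E) : E →L[ℝ] E →L[ℝ] E →L[ℝ] ℝ :=
  let D : E →L[ℝ] E →L[ℝ] E →L[ℝ] ℝ := fderiv ℝ G y
  let D' : E →L[ℝ] E →L[ℝ] E →L[ℝ] ℝ :=
    (ContinuousLinearMap.flipₗᵢ ℝ E E ℝ).toContinuousLinearEquiv.toContinuousLinearMap.comp D.flip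
  (1 / 2 : ℝ) • (D + D.flip - D')

theorem christoffelFirst_apply (G : E → E →L[ℝ] E →L[ℝ] ℝ) (y u v w : E) :
    christoffelFirst G y u v w =
      (1 / 2 : ℝ) * (fderiv ℝ G y u v w + fderiv ℝ G y v u w - fderiv ℝ G y w u v) := rfl

/-- The Christoffel symbols of the second kind (the Levi-Civita connection in coordinates):
`Γ(u, v)` is obtained from the covector `christoffelFirst G y u v` by raising the index, so that
`G(Γ(u, v), w) = ½ (∂_u G(v, w) + ∂_v G(u, w) - ∂_w G(u, v))`. -/
def christoffel (G : E → E →L[ℝ] E →L[ℝ] ℝ) (y : E) : E →L[ℝ] E →L[ℝ] E :=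
  (ContinuousLinearMap.compL ℝ E (E →L[ℝ] ℝ) E (G y).inverse).comp (christoffelFirst G y)

theorem christoffel_apply (G : E → E →L[ℝ] E →L[ℝ] ℝ) (y u v : E) :
    christoffel G y u v = (G y).inverse (christoffelFirst G y u v) := rfl

/-- The curvature `u ↦ R(u, v) w` in coordinates, where
`R(u, v) w = ∂_u Γ(v, w) - ∂_v Γ(u, w) + Γ(u, Γ(v, w)) - Γ(v, Γ(u, w))`,
that is, `R(X, Y) Z = ∇_X ∇_Y Z - ∇_Y ∇_X Z - ∇_[X, Y] Z`. -/
def curvatureMap (G : E → E →L[ℝ] E →L[ℝ] ℝ) (y v w : E) : E →L[ℝ] E :=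
  ((fderiv ℝ (christoffel G) y).flip v).flip w - (fderiv ℝ (christoffel G) y v).flip w
    + (christoffel G y).flip (christoffel G y v w)
    - (christoffel G y v).comp ((christoffel G y).flip w)

theorem curvatureMap_apply (G : E → E →L[ℝ] E →L[ℝ] ℝ) (y u v w : E) :
    curvatureMap G y v w u =
      fderiv ℝ (christoffel G) y u v w - fderiv ℝ (christoffel G) y v u w
        + christoffel G y u (christoffel G y v w)
        - christoffel G y v (christoffel G y u w) := rfl

/-- The Ricci tensor in coordinates: `Ric(v, w)` is the trace of `u ↦ R(u, v) w`. -/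
def coordRicci (G : E → E →L[ℝ] E →L[ℝ] ℝ) (y v w : E) : ℝ :=
  LinearMap.trace ℝ E (curvatureMap G y v w : E →ₗ[ℝ] E)

/-- The Hessian of a function in coordinates:
`Hess φ (u, v) = ∂_u ∂_v φ - dφ(Γ(u, v))`. -/
def coordHessian (G : E → E →L[ℝ] E →L[ℝ] ℝ) (φ : E → ℝ) (y u v : E) : ℝ :=
  fderiv ℝ (fderiv ℝ φ) y u v - fderiv ℝ φ y (christoffel G y u v)

end Coordinates

/-! ### Riemannian manifolds (without boundary) -/

section Manifold

variable {E : Type*} [NormedAddCommGroup E] [NormedSpace ℝ E]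
  {H : Type*} [TopologicalSpace H] {I : ModelWithCorners ℝ E H}
  {M : Type*} [TopologicalSpace M] [ChartedSpace H M] [IsManifold I ∞ M]

/-- Smooth Riemannian metrics on a smooth manifold `M`. -/
abbrev RiemMetric (I : ModelWithCorners ℝ E H) (M : Type*) [TopologicalSpace M] [ChartedSpace H M]
    [IsManifold I ∞ M] :=
  Bundle.ContMDiffRiemannianMetric I ∞ E (fun x : M => TangentSpace I x)

/-- The expression of the metric `g` in the chart around `x`: the pullback of `g` under the inverse
of the chart. -/
def metricInChart (g : RiemMetric I M) (x : M) (y : E) : E →L[ℝ] E →L[ℝ] ℝ :=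
  let T : E →L[ℝ] E := mfderiv 𝓘(ℝ, E) I (extChartAt I x).symm y
  let b : E →L[ℝ] E →L[ℝ] ℝ := g.inner ((extChartAt I x).symm y)
  b.bilinearComp T T

theorem metricInChart_apply (g : RiemMetric I M) (x : M) (y v w : E) :
    metricInChart g x y v w = g.inner ((extChartAt I x).symm y)
      (mfderiv 𝓘(ℝ, E) I (extChartAt I x).symm y v)
      (mfderiv 𝓘(ℝ, E) I (extChartAt I x).symm y w) := rfl

variable [I.Boundaryless]

/-- The Ricci tensor of `g` at `x`, computed in the chart around `x`
(as a tensor, it does not depend on the chart). -/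
def ricci (g : RiemMetric I M) (x : M) (v w : TangentSpace I x) : ℝ :=
  coordRicci (metricInChart g x) (extChartAt I x x)
    (mfderiv I 𝓘(ℝ, E) (extChartAt I x) x v) (mfderiv I 𝓘(ℝ, E) (extChartAt I x) x w)

/-- The Hessian of `φ` with respect to `g` at `x`, computed in the chart around `x`
(as a tensor, it does not depend on the chart). -/
def hessian (g : RiemMetric I M) (φ : M → ℝ) (x : M) (v w : TangentSpace I x) : ℝ :=
  coordHessian (metricInChart g x) (φ ∘ (extChartAt I x).symm) (extChartAt I x x)
    (mfderiv I 𝓘(ℝ, E) (extChartAt I x) x v) (mfderiv I 𝓘(ℝ, E) (extChartAt I x) x w)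

/-- `(M, g)` is Einstein with constant Ricci curvature `c`: `Ric = c g`. -/
def IsEinsteinWith (g : RiemMetric I M) (c : ℝ) : Prop :=
  ∀ (x : M) (v w : TangentSpace I x), ricci g x v w = c * g.inner x v w

/-- `(M, g)` is a gradient Ricci soliton with potential function `φ` and constant `ρ`:
`φ` is smooth and `Ric + Hess φ = ρ g`. -/
def IsGradientRicciSoliton (g : RiemMetric I M) (φ : M → ℝ) (ρ : ℝ) : Prop :=
  ContMDiff I 𝓘(ℝ) ∞ φ ∧
    ∀ (x : M) (v w : TangentSpace I x), ricci g x v w + hessian g φ x v w = ρ * g.inner x v w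

end Manifold

/-! ### Warped products -/

section Warped

variable {E : Type*} [NormedAddCommGroup E] [NormedSpace ℝ E]
  {H : Type*} [TopologicalSpace H] {I : ModelWithCorners ℝ E H}
  {B : Type*} [TopologicalSpace B] [ChartedSpace H B] [IsManifold I ∞ B]
  {E' : Type*} [NormedAddCommGroup E'] [NormedSpace ℝ E']
  {H' : Type*} [TopologicalSpace H'] {J : ModelWithCorners ℝ E' H'}
  {F : Type*} [TopologicalSpace F] [ChartedSpace H' F] [IsManifold J ∞ F]

/-- The symmetric form `π^* g_B + (f ∘ π)² σ^* g_F` on the tangent spaces of `B × F`,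
where `π` and `σ` are the projections of `B × F` to `B` and `F`. -/
def warpedInner (gB : RiemMetric I B) (gF : RiemMetric J F) (f : B → ℝ) (x : B × F) :
    TangentSpace (I.prod J) x →L[ℝ] TangentSpace (I.prod J) x →L[ℝ] ℝ :=
  let b : E →L[ℝ] E →L[ℝ] ℝ := gB.inner x.1
  let c : E' →L[ℝ] E' →L[ℝ] ℝ := gF.inner x.2
  let p : E × E' →L[ℝ] E := mfderiv (I.prod J) I (Prod.fst : B × F → B) x
  let q : E × E' →L[ℝ] E' := mfderiv (I.prod J) J (Prod.snd : B × F → F) x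
  (b.bilinearComp p p + (f x.1) ^ 2 • c.bilinearComp q q : E × E' →L[ℝ] E × E' →L[ℝ] ℝ)

theorem warpedInner_apply (gB : RiemMetric I B) (gF : RiemMetric J F) (f : B → ℝ) (x : B × F)
    (v w : TangentSpace (I.prod J) x) :
    warpedInner gB gF f x v w =
      gB.inner x.1 (mfderiv (I.prod J) I Prod.fst x v) (mfderiv (I.prod J) I Prod.fst x w)
      + (f x.1) ^ 2 * gF.inner x.2
          (mfderiv (I.prod J) J Prod.snd x v) (mfderiv (I.prod J) J Prod.snd x w) := rfl

theorem metric_nonneg (g : RiemMetric I B) (x : B) (v : TangentSpace I x) : 0 ≤ g.inner x v v := by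
  rcases eq_or_ne v 0 with rfl | hv
  · simp
  · exact (g.pos _ v hv).le

theorem contMDiffAt_metric_apply {EN : Type*} [NormedAddCommGroup EN] [NormedSpace ℝ EN]
    {HN : Type*} [TopologicalSpace HN] {K : ModelWithCorners ℝ EN HN}
    {N : Type*} [TopologicalSpace N] [ChartedSpace HN N]
    (g : RiemMetric I B) {b : N → B} {V W : ∀ x : N, TangentSpace I (b x)} {x₀ : N}
    (hb : ContMDiffAt K I ∞ b x₀)
    (hV : ContMDiffAt K (I.prod 𝓘(ℝ, E)) ∞ (fun x => (⟨b x, V x⟩ : TangentBundle I B)) x₀)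
    (hW : ContMDiffAt K (I.prod 𝓘(ℝ, E)) ∞ (fun x => (⟨b x, W x⟩ : TangentBundle I B)) x₀) :
    ContMDiffAt K 𝓘(ℝ) ∞ (fun x => g.inner (b x) (V x) (W x)) x₀ := by
  have hg := (g.contMDiff.contMDiffAt (x := b x₀)).comp x₀ hb
  have := ContMDiffAt.clm_bundle_apply₂ (F₁ := E) (F₂ := E) (F₃ := ℝ)
    (E₃ := Bundle.Trivial B ℝ) hg hV hW
  exact (Bundle.contMDiffAt_totalSpace.1 this).2

variable [FiniteDimensional ℝ E] [FiniteDimensional ℝ E']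

/-- A family of bilinear forms on the tangent spaces is smooth as soon as its values on smooth
local vector fields are smooth. -/
theorem contMDiff_bilin_of_apply {g : ∀ x : B, TangentSpace I x →L[ℝ] TangentSpace I x →L[ℝ] ℝ}
    (h : ∀ (x₀ : B) (V W : ∀ x : B, TangentSpace I x),
      ContMDiffAt I (I.prod 𝓘(ℝ, E)) ∞ (fun x => (⟨x, V x⟩ : TangentBundle I B)) x₀ →
      ContMDiffAt I (I.prod 𝓘(ℝ, E)) ∞ (fun x => (⟨x, W x⟩ : TangentBundle I B)) x₀ →
      ContMDiffAt I 𝓘(ℝ) ∞ (fun x => g x (V x) (W x)) x₀) :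
    ContMDiff I (I.prod 𝓘(ℝ, E →L[ℝ] E →L[ℝ] ℝ)) ∞
      (fun x => Bundle.TotalSpace.mk' (E →L[ℝ] E →L[ℝ] ℝ)
        (E := fun x : B => TangentSpace I x →L[ℝ] TangentSpace I x →L[ℝ] ℝ) x (g x)) := by
  intro x₀
  rw [contMDiffAt_hom_bundle]
  refine ⟨contMDiffAt_id, ?_⟩
  set e := trivializationAt E (TangentSpace I : B → Type _) x₀ with he
  have hx₀ : x₀ ∈ e.baseSet := FiberBundle.mem_baseSet_trivializationAt' x₀
  have hnhd : e.baseSet ∈ nhds x₀ := e.open_baseSet.mem_nhds hx₀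
  have hsec : ∀ u : E, ContMDiffAt I (I.prod 𝓘(ℝ, E)) ∞
      (fun x => (⟨x, e.symmL ℝ x u⟩ : TangentBundle I B)) x₀ := by
    intro u
    have hs : ContMDiffOn I (I.prod 𝓘(ℝ, E)) ∞
        (fun x => (⟨x, e.symmL ℝ x u⟩ : TangentBundle I B)) e.baseSet := by
      rw [e.contMDiffOn_section_baseSet_iff]
      apply (contMDiffOn_const (c := u)).congr
      intro y hy
      simp [hy]
    exact hs.contMDiffAt hnhd
  let b := Module.finBasis ℝ E
  let c : ∀ _ : Fin (Module.finrank ℝ E), E →L[ℝ] ℝ := fun i => (b.coord i).toContinuousLinearMap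
  have key : ∀ᶠ x in nhds x₀,
      ContinuousLinearMap.inCoordinates E (TangentSpace I) (E →L[ℝ] ℝ)
        (fun x : B => TangentSpace I x →L[ℝ] ℝ) x₀ x x₀ x (g x) =
      ∑ i, ∑ j, g x (e.symmL ℝ x (b i)) (e.symmL ℝ x (b j)) • (c i).smulRight (c j) := by
    filter_upwards [hnhd] with x hx
    have hL : ∀ u w : E, ContinuousLinearMap.inCoordinates E (TangentSpace I) (E →L[ℝ] ℝ)
        (fun x : B => TangentSpace I x →L[ℝ] ℝ) x₀ x x₀ x (g x) u w =
        g x (e.symmL ℝ x u) (e.symmL ℝ x w) := by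
      intro u w
      rw [inCoordinates_apply_eq₂ hx hx (by simp), e.symmL_apply hx, e.symmL_apply hx]
      simp [he]
    ext u w
    rw [hL]
    have hb : ∀ z : E, z = ∑ i, c i z • b i := fun z => (b.sum_repr z).symm
    conv_lhs => rw [hb u, hb w]
    simp only [map_sum, map_smul, sum_apply, smul_apply,
      ContinuousLinearMap.smulRight_apply, smul_eq_mul, Finset.mul_sum]
    rw [Finset.sum_comm]
    refine Finset.sum_congr rfl fun i _ => Finset.sum_congr rfl fun j _ => ?_
    ring
  refine ContMDiffAt.congr_of_eventuallyEq ?_ key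
  refine contMDiffAt_finsetSum fun i _ => contMDiffAt_finsetSum fun j _ => ?_
  exact (h x₀ _ _ (hsec (b i)) (hsec (b j))).smul contMDiffAt_const

/-- The warped product metric `g_B ⊕ f² g_F` on `B × F`. -/
def warpedProduct (gB : RiemMetric I B) (gF : RiemMetric J F) (f : B → ℝ)
    (hf : ContMDiff I 𝓘(ℝ) ∞ f) (hpos : ∀ b, 0 < f b) : RiemMetric (I.prod J) (B × F) where
  inner := warpedInner gB gF f
  symm x v w := by
    rw [warpedInner_apply, warpedInner_apply, gB.symm, gF.symm]
  pos x v hv := by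
    rw [warpedInner_apply]
    have h2 : 0 < (f x.1) ^ 2 := pow_pos (hpos _) 2
    by_cases h : mfderiv (I.prod J) I (Prod.fst : B × F → B) x v = 0
    · have h' : mfderiv (I.prod J) J (Prod.snd : B × F → F) x v ≠ 0 :=
        fun h' => hv (by
          rw [mfderiv_fst] at h
          rw [mfderiv_snd] at h'
          exact Prod.ext h h')
      exact add_pos_of_nonneg_of_pos (metric_nonneg gB _ _) (mul_pos h2 (gF.pos _ _ h'))
    · exact add_pos_of_pos_of_nonneg (gB.pos _ _ h) (mul_nonneg h2.le (metric_nonneg gF _ _))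
  isVonNBounded x := by
    have h2 : 0 < f x.1 := hpos _
    have hB : Bornology.IsBounded ({v : E | gB.inner x.1 v v < 1} : Set E) :=
      (NormedSpace.isVonNBounded_iff ℝ).1 (gB.isVonNBounded x.1)
    have hF : Bornology.IsBounded ({v : E' | gF.inner x.2 v v < 1} : Set E') :=
      (NormedSpace.isVonNBounded_iff ℝ).1 (gF.isVonNBounded x.2)
    have hP := hB.prod (hF.smul₀ (f x.1)⁻¹)
    have hS : Bornology.IsBounded ({v : E × E' | warpedInner gB gF f x v v < 1} : Set (E × E')) := by
      refine hP.subset fun v hv => ?_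
      have hv' : gB.inner x.1 v.1 v.1 + (f x.1) ^ 2 * gF.inner x.2 v.2 v.2 < 1 := by
        have := warpedInner_apply gB gF f x v v
        rw [mfderiv_fst, mfderiv_snd] at this
        exact this ▸ hv
      have h₁ := metric_nonneg gB x.1 v.1
      have h₂ := mul_nonneg (sq_nonneg (f x.1)) (metric_nonneg gF x.2 v.2)
      refine ⟨show gB.inner x.1 v.1 v.1 < 1 by linarith, ?_⟩
      rw [Set.mem_inv_smul_set_iff₀ h2.ne']
      have hc : ∀ c : E' →L[ℝ] E' →L[ℝ] ℝ, c (f x.1 • v.2) (f x.1 • v.2)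
          = (f x.1) ^ 2 * c v.2 v.2 := fun c => by
        simp only [map_smul, smul_apply, smul_eq_mul]
        ring
      have hc' := hc (gF.inner x.2)
      show gF.inner x.2 (f x.1 • v.2) (f x.1 • v.2) < 1
      exact hc'.trans_lt (lt_of_le_of_lt (le_add_of_nonneg_left h₁) hv')
    exact (NormedSpace.isVonNBounded_iff ℝ).2 hS
  contMDiff := by
    refine contMDiff_bilin_of_apply fun x₀ V W hV hW => ?_
    have hfst : ∀ V : ∀ x : B × F, TangentSpace (I.prod J) x,
        ContMDiffAt (I.prod J) ((I.prod J).prod 𝓘(ℝ, E × E')) ∞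
          (fun x => (⟨x, V x⟩ : TangentBundle (I.prod J) (B × F))) x₀ →
        ContMDiffAt (I.prod J) (I.prod 𝓘(ℝ, E)) ∞
          (fun x => (⟨x.1, mfderiv (I.prod J) I Prod.fst x (V x)⟩ : TangentBundle I B)) x₀ :=
      fun V hV => ((contMDiff_fst.contMDiff_tangentMap (m := ∞) le_rfl).contMDiffAt).comp x₀ hV
    have hsnd : ∀ V : ∀ x : B × F, TangentSpace (I.prod J) x,
        ContMDiffAt (I.prod J) ((I.prod J).prod 𝓘(ℝ, E × E')) ∞
          (fun x => (⟨x, V x⟩ : TangentBundle (I.prod J) (B × F))) x₀ →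
        ContMDiffAt (I.prod J) (J.prod 𝓘(ℝ, E')) ∞
          (fun x => (⟨x.2, mfderiv (I.prod J) J Prod.snd x (V x)⟩ : TangentBundle J F)) x₀ :=
      fun V hV => ((contMDiff_snd.contMDiff_tangentMap (m := ∞) le_rfl).contMDiffAt).comp x₀ hV
    have h₁ : ContMDiffAt (I.prod J) 𝓘(ℝ) ∞ (fun x : B × F => gB.inner x.1
        (mfderiv (I.prod J) I Prod.fst x (V x)) (mfderiv (I.prod J) I Prod.fst x (W x))) x₀ :=
      contMDiffAt_metric_apply gB contMDiffAt_fst (hfst V hV) (hfst W hW)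
    have h₂ : ContMDiffAt (I.prod J) 𝓘(ℝ) ∞ (fun x : B × F => gF.inner x.2
        (mfderiv (I.prod J) J Prod.snd x (V x)) (mfderiv (I.prod J) J Prod.snd x (W x))) x₀ :=
      contMDiffAt_metric_apply gF contMDiffAt_snd (hsnd V hV) (hsnd W hW)
    have h₃ : ContMDiffAt (I.prod J) 𝓘(ℝ) ∞ (fun x : B × F => f x.1) x₀ :=
      hf.contMDiffAt.comp x₀ contMDiffAt_fst
    exact h₁.add ((h₃.pow 2).mul h₂)

end Warped

/-- The standard metric of Euclidean space. -/
def euclideanMetric (n : ℕ) : RiemMetric 𝓘(ℝ, EuclideanSpace ℝ (Fin n)) (EuclideanSpace ℝ (Fin n)) :=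
  { riemannianMetricVectorSpace (EuclideanSpace ℝ (Fin n)) with
    contMDiff := (riemannianMetricVectorSpace (EuclideanSpace ℝ (Fin n))).contMDiff.of_le le_top }

theorem euclideanMetric_apply (n : ℕ) (x v w : EuclideanSpace ℝ (Fin n)) :
    (euclideanMetric n).inner x v w = inner ℝ v w := rfl

/-- The partial derivative of `f` with respect to the `i`-th coordinate of `ℝⁿ`. -/
def pderiv {n : ℕ} (i : Fin n) (f : EuclideanSpace ℝ (Fin n) → ℝ)
    (x : EuclideanSpace ℝ (Fin n)) : ℝ :=
  fderiv ℝ f x (EuclideanSpace.single i 1)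

end RicciSoliton

end

/-!
The Ricci tensor and the Hessian are computed in a product chart of `ℝⁿ × F`, the identity times a
chart of `F`. There the warped metric is `⟨·, ·⟩ ⊕ f² G`, with `G` the expression of `g_F`
(`metricInChart_warpedProduct`), and its Christoffel symbols are explicit
(`christoffel_warpedForm`):
`Γ(u, v) = (-f G(u₂, v₂) ∇f, Γ_G(u₂, v₂) + (df(u₁) / f) v₂ + (df(v₁) / f) u₂)`.
Differentiating this formula gives the curvature. The trace over the base block of the curvature
operator contributes `-f Δf G(v₂, w₂)`, and the trace over the fiber block
`Ric_F(v₂, w₂) - (m / f) D²f(v₁, w₁) - (m - 1) |∇f|² G(v₂, w₂)`; their sum is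
`ricci_warpedProduct`. The Hessian of `h` is `D²h(v₁, w₁) + f ⟨∇f, ∇h⟩ G(v₂, w₂)`
(`hessian_warpedProduct`).

With `Ric_F = λ_F g_F`, the soliton equation therefore has no mixed terms. It says that a bilinear
form on `ℝⁿ`, evaluated on `(v₁, w₁)`, plus a function on `ℝⁿ` times `g_F(v₂, w₂)` vanishes.
Since `F` is nonempty and of positive dimension, this happens only if both vanish
(`isGradientRicciSoliton_warpedProduct_iff`). The components of the bilinear form in the standard
basis give the first two families of equations, and the factor of `g_F` gives the third.
-/

namespace RicciSoliton

open Filter Topology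
open scoped Gradient

/-! ### Christoffel symbols of a nondegenerate metric tensor -/

section Coordinates

variable {E : Type*} [NormedAddCommGroup E] [NormedSpace ℝ E]

/-- A family of continuous linear maps on a finite-dimensional space is smooth at a point if all
its values are. -/
theorem _root_.ContDiffAt.of_clm_apply {X Y Z : Type*} [NormedAddCommGroup X] [NormedSpace ℝ X]
    [NormedAddCommGroup Y] [NormedSpace ℝ Y] [NormedAddCommGroup Z] [NormedSpace ℝ Z]
    [FiniteDimensional ℝ Y] {n : WithTop ℕ∞} {f : X → Y →L[ℝ] Z} {x : X}
    (h : ∀ v, ContDiffAt ℝ n (fun p => f p v) x) : ContDiffAt ℝ n f x := by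
  let b := Module.finBasis ℝ Y
  let c : Fin (Module.finrank ℝ Y) → Y →L[ℝ] ℝ := fun i => (b.coord i).toContinuousLinearMap
  have hf : f = fun p => ∑ i, (c i).smulRight (f p (b i)) := by
    funext p
    ext v
    conv_lhs => rw [← b.sum_repr v]
    simp [c, -Module.Basis.sum_repr]
  rw [hf]
  exact ContDiffAt.sum fun i _ => contDiffAt_const.smulRight (h (b i))

/-- A positive definite form on a finite-dimensional space is nondegenerate, so that indices can be
raised with its `ContinuousLinearMap.inverse`. -/
theorem isInvertible_of_pos [FiniteDimensional ℝ E] {b : E →L[ℝ] E →L[ℝ] ℝ}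
    (hb : ∀ v, v ≠ 0 → 0 < b v v) : b.IsInvertible := by
  have hinj : Function.Injective (b : E →ₗ[ℝ] E →L[ℝ] ℝ) := by
    rw [injective_iff_map_eq_zero]
    intro v hv
    by_contra hne
    have h0 : b v = 0 := hv
    have := hb v hne
    simp [h0] at this
  have hdim : Module.finrank ℝ E = Module.finrank ℝ (E →L[ℝ] ℝ) := by
    rw [← (LinearMap.toContinuousLinearMap (𝕜 := ℝ) (E := E) (F' := ℝ)).finrank_eq]
    exact (Subspace.dual_finrank_eq (K := ℝ) (V := E)).symm
  refine ⟨(LinearMap.linearEquivOfInjective _ hinj hdim).toContinuousLinearEquiv, ?_⟩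
  ext v w
  rfl

theorem christoffelFirst_symm {G : E → E →L[ℝ] E →L[ℝ] ℝ} {y : E}
    (hG : DifferentiableAt ℝ G y) (hs : ∀ᶠ p in 𝓝 y, ∀ v w, G p v w = G p w v) (u v : E) :
    christoffelFirst G y u v = christoffelFirst G y v u := by
  ext w
  have h : fderiv ℝ G y w u v = fderiv ℝ G y w v u := by
    have h1 : ∀ a b : E, HasFDerivAt (fun p => G p a b)
        (((fderiv ℝ G y).flip a).flip b) y := fun a b => by
      simpa using! (hG.hasFDerivAt.clm_apply (hasFDerivAt_const a y)).clm_apply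
        (hasFDerivAt_const b y)
    have h2 : (fun p => G p u v) =ᶠ[𝓝 y] fun p => G p v u := hs.mono fun p hp => hp u v
    exact congrArg (fun L : E →L[ℝ] ℝ => L w) ((h1 u v).unique ((h1 v u).congr_of_eventuallyEq h2))
  rw [christoffelFirst_apply, christoffelFirst_apply, h]
  ring

theorem christoffel_symm {G : E → E →L[ℝ] E →L[ℝ] ℝ} {y : E}
    (hG : DifferentiableAt ℝ G y) (hs : ∀ᶠ p in 𝓝 y, ∀ v w, G p v w = G p w v) (u v : E) :
    christoffel G y u v = christoffel G y v u := by
  rw [christoffel_apply, christoffel_apply, christoffelFirst_symm hG hs]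

theorem metric_christoffel_apply {G : E → E →L[ℝ] E →L[ℝ] ℝ} {y : E} (hi : (G y).IsInvertible)
    (u v w : E) : G y (christoffel G y u v) w = christoffelFirst G y u v w := by
  have h := (hi.inverse_apply_eq (x := christoffel G y u v)).1 (christoffel_apply G y u v).symm
  rw [h]

theorem christoffel_eq_of_metric_eq {G : E → E →L[ℝ] E →L[ℝ] ℝ} {y : E}
    (hi : (G y).IsInvertible) {u v x : E}
    (h : ∀ w, G y x w = christoffelFirst G y u v w) : christoffel G y u v = x := by
  rw [christoffel_apply, hi.inverse_apply_eq]
  ext w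
  exact (h w).symm

theorem contDiffAt_christoffel [FiniteDimensional ℝ E] {G : E → E →L[ℝ] E →L[ℝ] ℝ} {y : E}
    (hG : ContDiffAt ℝ ∞ G y) (hi : (G y).IsInvertible) :
    ContDiffAt ℝ ∞ (christoffel G) y := by
  have hD : ContDiffAt ℝ ∞ (fderiv ℝ G) y := hG.fderiv_right (by simp)
  have hfirst : ContDiffAt ℝ ∞ (christoffelFirst G) y := by
    refine .of_clm_apply fun u => .of_clm_apply fun v => .of_clm_apply fun w => ?_
    have hD' : ∀ a b c : E, ContDiffAt ℝ ∞ (fun p => fderiv ℝ G p a b c) y := fun a b c =>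
      ((hD.clm_apply contDiffAt_const).clm_apply contDiffAt_const).clm_apply contDiffAt_const
    simp only [christoffelFirst_apply]
    exact contDiffAt_const.mul (((hD' u v w).add (hD' v u w)).sub (hD' w u v))
  have : CompleteSpace E := FiniteDimensional.complete ℝ E
  have hinv : ContDiffAt ℝ ∞ (fun p => (G p).inverse) y :=
    hi.contDiffAt_map_inverse.comp y hG
  unfold christoffel
  exact ((ContinuousLinearMap.compL ℝ E (E →L[ℝ] ℝ) E).contDiff.contDiffAt.comp y hinv).clm_comp
    hfirst

theorem fderiv_christoffel_apply {G : E → E →L[ℝ] E →L[ℝ] ℝ} {y : E}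
    (h : DifferentiableAt ℝ (christoffel G) y) (u v w : E) :
    fderiv ℝ (christoffel G) y u v w = fderiv ℝ (fun p => christoffel G p v w) y u := by
  have h1 : HasFDerivAt (fun p => christoffel G p v w)
      (((fderiv ℝ (christoffel G) y).flip v).flip w) y := by
    simpa using! (h.hasFDerivAt.clm_apply (hasFDerivAt_const v y)).clm_apply
      (hasFDerivAt_const w y)
  rw [h1.fderiv]
  rfl

theorem christoffel_congr {G G' : E → E →L[ℝ] E →L[ℝ] ℝ} {y : E} (h : G =ᶠ[𝓝 y] G') :
    christoffel G =ᶠ[𝓝 y] christoffel G' := by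
  filter_upwards [h.eventuallyEq_nhds] with p hp
  simp only [christoffel, christoffelFirst, hp.fderiv_eq, hp.eq_of_nhds]

theorem coordRicci_congr {G G' : E → E →L[ℝ] E →L[ℝ] ℝ} {y : E} (h : G =ᶠ[𝓝 y] G') (v w : E) :
    coordRicci G y v w = coordRicci G' y v w := by
  have hc := christoffel_congr h
  simp only [coordRicci, curvatureMap, hc.fderiv_eq, hc.eq_of_nhds]

theorem coordHessian_congr {G G' : E → E →L[ℝ] E →L[ℝ] ℝ} {y : E} (h : G =ᶠ[𝓝 y] G')
    (φ : E → ℝ) (v w : E) : coordHessian G φ y v w = coordHessian G' φ y v w := by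
  simp only [coordHessian, (christoffel_congr h).eq_of_nhds]

end Coordinates

/-- The trace of an endomorphism of a product is the sum of the traces of its diagonal blocks. -/
theorem trace_prod_eq_add {R V W : Type*} [CommRing R] [AddCommGroup V] [Module R V]
    [AddCommGroup W] [Module R W] [Module.Free R V] [Module.Finite R V] [Module.Free R W]
    [Module.Finite R W] (A : V × W →ₗ[R] V × W) :
    LinearMap.trace R (V × W) A =
      LinearMap.trace R V (LinearMap.fst R V W ∘ₗ A ∘ₗ LinearMap.inl R V W) +
      LinearMap.trace R W (LinearMap.snd R V W ∘ₗ A ∘ₗ LinearMap.inr R V W) := by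
  have h : A = LinearMap.inl R V W ∘ₗ (LinearMap.fst R V W ∘ₗ A) +
      LinearMap.inr R V W ∘ₗ (LinearMap.snd R V W ∘ₗ A) := by
    ext v <;> simp
  conv_lhs => rw [h]
  rw [map_add, LinearMap.trace_comp_comm' (LinearMap.fst R V W ∘ₗ A),
    LinearMap.trace_comp_comm' (LinearMap.snd R V W ∘ₗ A)]
  rfl

/-! ### Curvature of a warped product in coordinates -/

section WarpedCoordinates

variable {E : Type*} [NormedAddCommGroup E] [InnerProductSpace ℝ E]
  {E' : Type*} [NormedAddCommGroup E'] [NormedSpace ℝ E']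

/-- The metric tensor `⟨·, ·⟩ ⊕ f² G` on `E × E'`, for `E` with its flat metric. -/
noncomputable def warpedForm (f : E → ℝ) (G : E' → E' →L[ℝ] E' →L[ℝ] ℝ) (p : E × E') :
    E × E' →L[ℝ] E × E' →L[ℝ] ℝ :=
  let b : E →L[ℝ] E →L[ℝ] ℝ := innerSL ℝ
  b.bilinearComp (.fst ℝ E E') (.fst ℝ E E') +
    (f p.1) ^ 2 • (G p.2).bilinearComp (.snd ℝ E E') (.snd ℝ E E')

theorem warpedForm_apply (f : E → ℝ) (G : E' → E' →L[ℝ] E' →L[ℝ] ℝ) (p v w : E × E') :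
    warpedForm f G p v w = inner ℝ v.1 w.1 + (f p.1) ^ 2 * G p.2 v.2 w.2 := rfl

theorem warpedForm_pos {f : E → ℝ} {G : E' → E' →L[ℝ] E' →L[ℝ] ℝ} {p : E × E'}
    (hf : f p.1 ≠ 0) (hG : ∀ v, v ≠ 0 → 0 < G p.2 v v) (v : E × E') (hv : v ≠ 0) :
    0 < warpedForm f G p v v := by
  rw [warpedForm_apply]
  have h2 : 0 < (f p.1) ^ 2 := by positivity
  by_cases h : v.2 = 0
  · have h1 : v.1 ≠ 0 := fun h1 => hv (Prod.ext h1 h)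
    simpa [h] using real_inner_self_pos.2 h1
  · exact add_pos_of_nonneg_of_pos real_inner_self_nonneg (mul_pos h2 (hG _ h))

variable [FiniteDimensional ℝ E] [FiniteDimensional ℝ E']

theorem contDiffAt_warpedForm {f : E → ℝ} {G : E' → E' →L[ℝ] E' →L[ℝ] ℝ} {p : E × E'}
    (hf : ContDiffAt ℝ ∞ f p.1) (hG : ContDiffAt ℝ ∞ G p.2) :
    ContDiffAt ℝ ∞ (warpedForm f G) p := by
  refine .of_clm_apply fun v => .of_clm_apply fun w => ?_
  simp only [warpedForm_apply]
  have h1 : ContDiffAt ℝ ∞ (fun q : E × E' => f q.1) p := hf.comp p contDiffAt_fst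
  have h2 : ContDiffAt ℝ ∞ (fun q : E × E' => G q.2) p := hG.comp p contDiffAt_snd
  exact contDiffAt_const.add
    ((h1.pow 2).mul ((h2.clm_apply contDiffAt_const).clm_apply contDiffAt_const))

theorem fderiv_warpedForm_apply {f : E → ℝ} {G : E' → E' →L[ℝ] E' →L[ℝ] ℝ} {p : E × E'}
    (hf : ContDiffAt ℝ ∞ f p.1) (hG : ContDiffAt ℝ ∞ G p.2) (u v w : E × E') :
    fderiv ℝ (warpedForm f G) p u v w =
      2 * f p.1 * fderiv ℝ f p.1 u.1 * G p.2 v.2 w.2 +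
        (f p.1) ^ 2 * fderiv ℝ G p.2 u.2 v.2 w.2 := by
  have h0 : HasFDerivAt (fun q => warpedForm f G q v w)
      (((fderiv ℝ (warpedForm f G) p).flip v).flip w) p := by
    simpa using! (((contDiffAt_warpedForm hf hG).differentiableAt (by simp)).hasFDerivAt.clm_apply
      (hasFDerivAt_const v p)).clm_apply (hasFDerivAt_const w p)
  have h1 : HasFDerivAt (fun q : E × E' => f q.1) _ p :=
    (hf.differentiableAt (by simp)).hasFDerivAt.comp p hasFDerivAt_fst
  have h2 : HasFDerivAt (fun q : E × E' => G q.2) _ p :=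
    (hG.differentiableAt (by simp)).hasFDerivAt.comp p hasFDerivAt_snd
  have h3 := ((h1.pow 2).mul ((h2.clm_apply (hasFDerivAt_const v.2 p)).clm_apply
    (hasFDerivAt_const w.2 p))).const_add (inner ℝ v.1 w.1 : ℝ)
  have h4 := congrArg (fun L : E × E' →L[ℝ] ℝ => L u) (h0.unique h3)
  refine h4.trans ?_
  simp
  ring

theorem inner_gradient_left (f : E → ℝ) (x v : E) : inner ℝ (∇ f x) v = fderiv ℝ f x v :=
  InnerProductSpace.toDual_symm_apply

/-- The Christoffel symbols of a warped product over a flat base. -/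
theorem christoffel_warpedForm {f : E → ℝ} {G : E' → E' →L[ℝ] E' →L[ℝ] ℝ} {p : E × E'}
    (hf : ContDiffAt ℝ ∞ f p.1) (hf0 : f p.1 ≠ 0) (hG : ContDiffAt ℝ ∞ G p.2)
    (hpos : ∀ v, v ≠ 0 → 0 < G p.2 v v) (u v : E × E') :
    christoffel (warpedForm f G) p u v =
      (-(f p.1 * G p.2 u.2 v.2) • ∇ f p.1,
        christoffel G p.2 u.2 v.2 + (fderiv ℝ f p.1 u.1 / f p.1) • v.2
          + (fderiv ℝ f p.1 v.1 / f p.1) • u.2) := by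
  refine christoffel_eq_of_metric_eq (isInvertible_of_pos (warpedForm_pos hf0 hpos)) fun w => ?_
  rw [christoffelFirst_apply, fderiv_warpedForm_apply hf hG, fderiv_warpedForm_apply hf hG,
    fderiv_warpedForm_apply hf hG, warpedForm_apply]
  simp only [map_add, map_smul, add_apply, smul_apply, smul_eq_mul, inner_smul_left,
    metric_christoffel_apply (isInvertible_of_pos hpos), christoffelFirst_apply,
    inner_gradient_left]
  simp
  field_simp
  ring

theorem differentiable_gradient {f : E → ℝ} (hf : ContDiff ℝ ∞ f) : Differentiable ℝ (∇ f) :=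
  ((InnerProductSpace.toDual ℝ E).symm.contDiff.comp
    (hf.fderiv_right (m := ∞) (by simp))).differentiable (by simp)

/-- The derivative of the Christoffel symbols of a warped product over a flat base. The hypotheses
on `G` are needed on a neighbourhood, where the explicit formula for the symbols is
differentiated. -/
theorem fderiv_christoffel_warpedForm {f : E → ℝ} {G : E' → E' →L[ℝ] E' →L[ℝ] ℝ} {p : E × E'}
    (hf : ContDiff ℝ ∞ f) (hf0 : ∀ x, f x ≠ 0) (hG : ∀ᶠ z in 𝓝 p.2, ContDiffAt ℝ ∞ G z)
    (hpos : ∀ᶠ z in 𝓝 p.2, ∀ v, v ≠ 0 → 0 < G z v v) (u v w : E × E') :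
    fderiv ℝ (christoffel (warpedForm f G)) p u v w =
      (-(fderiv ℝ f p.1 u.1 * G p.2 v.2 w.2 + f p.1 * fderiv ℝ G p.2 u.2 v.2 w.2) • ∇ f p.1
          - (f p.1 * G p.2 v.2 w.2) • fderiv ℝ (∇ f) p.1 u.1,
        fderiv ℝ (christoffel G) p.2 u.2 v.2 w.2
          + (fderiv ℝ (fderiv ℝ f) p.1 u.1 v.1 / f p.1
              - fderiv ℝ f p.1 u.1 * fderiv ℝ f p.1 v.1 / (f p.1) ^ 2) • w.2
          + (fderiv ℝ (fderiv ℝ f) p.1 u.1 w.1 / f p.1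
              - fderiv ℝ f p.1 u.1 * fderiv ℝ f p.1 w.1 / (f p.1) ^ 2) • v.2) := by
  have hGp := hG.self_of_nhds
  have hposp := hpos.self_of_nhds
  have hWd : DifferentiableAt ℝ (christoffel (warpedForm f G)) p :=
    (contDiffAt_christoffel (contDiffAt_warpedForm hf.contDiffAt hGp)
      (isInvertible_of_pos (warpedForm_pos (hf0 _) hposp))).differentiableAt (by simp)
  have hev : (fun q => christoffel (warpedForm f G) q v w) =ᶠ[𝓝 p] fun q =>
      (-(f q.1 * G q.2 v.2 w.2) • ∇ f q.1,
        christoffel G q.2 v.2 w.2 + (fderiv ℝ f q.1 v.1 * (f q.1)⁻¹) • w.2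
          + (fderiv ℝ f q.1 w.1 * (f q.1)⁻¹) • v.2) := by
    filter_upwards [continuousAt_snd.eventually hG, continuousAt_snd.eventually hpos] with q h1 h2
    exact christoffel_warpedForm hf.contDiffAt (hf0 _) h1 h2 v w
  have hfd : ContDiff ℝ ∞ (fderiv ℝ f) := hf.fderiv_right (by simp)
  have hgrad := differentiable_gradient hf
  have h1 : HasFDerivAt (fun q : E × E' => f q.1) _ p :=
    (hf.differentiable (by simp) p.1).hasFDerivAt.comp p hasFDerivAt_fst
  have h2 : HasFDerivAt (fun q : E × E' => G q.2) _ p :=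
    (hGp.differentiableAt (by simp)).hasFDerivAt.comp p hasFDerivAt_snd
  have h2' := (h2.clm_apply (hasFDerivAt_const v.2 p)).clm_apply (hasFDerivAt_const w.2 p)
  have h3 : HasFDerivAt (fun q : E × E' => ∇ f q.1) _ p :=
    (hgrad p.1).hasFDerivAt.comp p hasFDerivAt_fst
  have h4 : HasFDerivAt (fun q : E × E' => fderiv ℝ f q.1) _ p :=
    (hfd.differentiable (by simp) p.1).hasFDerivAt.comp p hasFDerivAt_fst
  have h1' : HasFDerivAt (fun q : E × E' => (f q.1)⁻¹) _ p :=
    (hasDerivAt_inv (hf0 p.1)).comp_hasFDerivAt p h1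
  have h4' := fun a : E × E' => (h4.clm_apply (hasFDerivAt_const a.1 p)).fun_mul h1'
  have h5 : HasFDerivAt (fun q : E × E' => christoffel G q.2) _ p :=
    ((contDiffAt_christoffel hGp (isInvertible_of_pos hposp)).differentiableAt
      (by simp)).hasFDerivAt.comp p hasFDerivAt_snd
  have h5' := (h5.clm_apply (hasFDerivAt_const v.2 p)).clm_apply (hasFDerivAt_const w.2 p)
  have h6 := ((h1.fun_mul h2').fun_neg.fun_smul h3).prodMk
    ((h5'.fun_add ((h4' v).smul_const w.2)).fun_add ((h4' w).smul_const v.2))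
  rw [fderiv_christoffel_apply hWd, hev.fderiv_eq, h6.fderiv]
  have hf0' := hf0 p.1
  ext
  · simp
    module
  · simp
    match_scalars <;> field_simp <;> ring

/-- The base block of the curvature operator. The terms with `∇f ⊗ df` coming from `∂Γ` and from
`Γ Γ` cancel, and only the Hessian of `f` remains. -/
theorem curvatureMap_warpedForm_fst {f : E → ℝ} {G : E' → E' →L[ℝ] E' →L[ℝ] ℝ} {p : E × E'}
    (hf : ContDiff ℝ ∞ f) (hf0 : ∀ x, f x ≠ 0) (hG : ∀ᶠ z in 𝓝 p.2, ContDiffAt ℝ ∞ G z)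
    (hpos : ∀ᶠ z in 𝓝 p.2, ∀ v, v ≠ 0 → 0 < G z v v) (v w : E × E') (a : E) :
    (curvatureMap (warpedForm f G) p v w (a, 0)).1 =
      -(f p.1 * G p.2 v.2 w.2) • fderiv ℝ (∇ f) p.1 a := by
  have hΓ := christoffel_warpedForm (f := f) hf.contDiffAt (hf0 p.1) hG.self_of_nhds
    hpos.self_of_nhds
  have hf0' := hf0 p.1
  rw [curvatureMap_apply]
  simp only [fderiv_christoffel_warpedForm hf hf0 hG hpos, hΓ, map_zero, zero_apply,
    Prod.fst_add, Prod.fst_sub, mul_zero, zero_smul, smul_zero, add_zero, zero_add, neg_zero,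
    map_smul, smul_eq_mul, sub_zero]
  match_scalars <;> field_simp
  ring

/-- The fiber block of the curvature operator: the curvature of the fiber, a multiple of the
identity, and a rank one term. -/
theorem curvatureMap_warpedForm_snd {f : E → ℝ} {G : E' → E' →L[ℝ] E' →L[ℝ] ℝ} {p : E × E'}
    (hf : ContDiff ℝ ∞ f) (hf0 : ∀ x, f x ≠ 0) (hG : ∀ᶠ z in 𝓝 p.2, ContDiffAt ℝ ∞ G z)
    (hsymm : ∀ᶠ z in 𝓝 p.2, ∀ v w, G z v w = G z w v)
    (hpos : ∀ᶠ z in 𝓝 p.2, ∀ v, v ≠ 0 → 0 < G z v v) (v w : E × E') (c : E') :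
    (curvatureMap (warpedForm f G) p v w (0, c)).2 =
      curvatureMap G p.2 v.2 w.2 c
        - (fderiv ℝ (fderiv ℝ f) p.1 v.1 w.1 / f p.1 + fderiv ℝ f p.1 (∇ f p.1) * G p.2 v.2 w.2) • c
        + (fderiv ℝ f p.1 (∇ f p.1) * G p.2 c w.2) • v.2 := by
  have hΓ := christoffel_warpedForm (f := f) hf.contDiffAt (hf0 p.1) hG.self_of_nhds
    hpos.self_of_nhds
  have hf0' := hf0 p.1
  rw [curvatureMap_apply, curvatureMap_apply]
  simp only [fderiv_christoffel_warpedForm hf hf0 hG hpos, hΓ, map_zero, zero_apply,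
    Prod.snd_add, Prod.snd_sub, mul_zero, zero_mul, zero_div, zero_smul, smul_zero, add_zero,
    zero_add, map_smul, map_add, smul_eq_mul, sub_zero, sub_self]
  rw [christoffel_symm (hG.self_of_nhds.differentiableAt (by simp)) hsymm c v.2]
  match_scalars <;> field_simp <;> ring

/-- The Ricci tensor of a warped product over a flat base. -/
theorem coordRicci_warpedForm {f : E → ℝ} {G : E' → E' →L[ℝ] E' →L[ℝ] ℝ} {p : E × E'}
    (hf : ContDiff ℝ ∞ f) (hf0 : ∀ x, f x ≠ 0) (hG : ∀ᶠ z in 𝓝 p.2, ContDiffAt ℝ ∞ G z)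
    (hsymm : ∀ᶠ z in 𝓝 p.2, ∀ v w, G z v w = G z w v)
    (hpos : ∀ᶠ z in 𝓝 p.2, ∀ v, v ≠ 0 → 0 < G z v v) (v w : E × E') :
    coordRicci (warpedForm f G) p v w =
      coordRicci G p.2 v.2 w.2
        - Module.finrank ℝ E' * (fderiv ℝ (fderiv ℝ f) p.1 v.1 w.1 / f p.1)
        - (f p.1 * LinearMap.trace ℝ E (fderiv ℝ (∇ f) p.1 : E →ₗ[ℝ] E)
          + (Module.finrank ℝ E' - 1) * fderiv ℝ f p.1 (∇ f p.1)) * G p.2 v.2 w.2 := by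
  rw [coordRicci, trace_prod_eq_add]
  have h1 : LinearMap.fst ℝ E E' ∘ₗ (curvatureMap (warpedForm f G) p v w : E × E' →ₗ[ℝ] E × E')
      ∘ₗ LinearMap.inl ℝ E E' =
      (-(f p.1 * G p.2 v.2 w.2)) • (fderiv ℝ (∇ f) p.1 : E →ₗ[ℝ] E) :=
    LinearMap.ext fun a => curvatureMap_warpedForm_fst hf hf0 hG hpos v w a
  have h2 : LinearMap.snd ℝ E E' ∘ₗ (curvatureMap (warpedForm f G) p v w : E × E' →ₗ[ℝ] E × E')
      ∘ₗ LinearMap.inr ℝ E E' =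
      (curvatureMap G p.2 v.2 w.2 : E' →ₗ[ℝ] E')
        - (fderiv ℝ (fderiv ℝ f) p.1 v.1 w.1 / f p.1
            + fderiv ℝ f p.1 (∇ f p.1) * G p.2 v.2 w.2) • LinearMap.id
        + fderiv ℝ f p.1 (∇ f p.1) •
          ((G p.2).flip w.2 : E' →ₗ[ℝ] ℝ).smulRight v.2 := by
    refine LinearMap.ext fun c => ?_
    refine (curvatureMap_warpedForm_snd hf hf0 hG hsymm hpos v w c).trans ?_
    simp [mul_smul]
  rw [h1, h2]
  simp only [map_add, map_sub, map_smul, LinearMap.trace_id, LinearMap.trace_smulRight, coordRicci,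
    smul_eq_mul, ContinuousLinearMap.coe_coe, ContinuousLinearMap.flip_apply]
  ring

/-- The Hessian of a function on the base of a warped product over a flat base. -/
theorem coordHessian_warpedForm {f h : E → ℝ} {G : E' → E' →L[ℝ] E' →L[ℝ] ℝ} {p : E × E'}
    (hf : ContDiffAt ℝ ∞ f p.1) (hf0 : f p.1 ≠ 0) (hh : ContDiff ℝ ∞ h)
    (hG : ContDiffAt ℝ ∞ G p.2) (hpos : ∀ v, v ≠ 0 → 0 < G p.2 v v) (v w : E × E') :
    coordHessian (warpedForm f G) (fun q => h q.1) p v w =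
      fderiv ℝ (fderiv ℝ h) p.1 v.1 w.1
        + f p.1 * fderiv ℝ h p.1 (∇ f p.1) * G p.2 v.2 w.2 := by
  have h1 : fderiv ℝ (fun q : E × E' => h q.1) =
      fun q => (fderiv ℝ h q.1).comp (.fst ℝ E E') := funext fun q =>
    ((hh.differentiable (by simp) q.1).hasFDerivAt.comp q hasFDerivAt_fst).fderiv
  have hhd : ContDiff ℝ ∞ (fderiv ℝ h) := hh.fderiv_right (by simp)
  have h2 : HasFDerivAt (fun q : E × E' => fderiv ℝ h q.1) _ p :=
    (hhd.differentiable (by simp) p.1).hasFDerivAt.comp p hasFDerivAt_fst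
  have h3 := h2.clm_comp (hasFDerivAt_const (ContinuousLinearMap.fst ℝ E E') p)
  rw [coordHessian, h1, h3.fderiv, christoffel_warpedForm hf hf0 hG hpos]
  simp
  ring

/-- The trace of the derivative of the gradient is the Laplacian. -/
theorem trace_fderiv_gradient {ι : Type*} [Fintype ι] (b : OrthonormalBasis ι ℝ E) {f : E → ℝ}
    (hf : ContDiff ℝ ∞ f) (x : E) :
    LinearMap.trace ℝ E (fderiv ℝ (∇ f) x : E →ₗ[ℝ] E) =
      ∑ i, fderiv ℝ (fderiv ℝ f) x (b i) (b i) := by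
  have hfd : ContDiff ℝ ∞ (fderiv ℝ f) := hf.fderiv_right (by simp)
  have h : ∀ v, inner ℝ v (fderiv ℝ (∇ f) x v) = fderiv ℝ (fderiv ℝ f) x v v := fun v => by
    have h1 : HasFDerivAt (fun y => inner ℝ (∇ f y) v) _ x :=
      (differentiable_gradient hf x).hasFDerivAt.inner ℝ (hasFDerivAt_const v x)
    have h2 : HasFDerivAt (fun y => fderiv ℝ f y v) _ x :=
      (hfd.differentiable (by simp) x).hasFDerivAt.clm_apply (hasFDerivAt_const v x)
    simp only [inner_gradient_left] at h1
    simpa [real_inner_comm] using congrArg (fun L : E →L[ℝ] ℝ => L v) (h1.unique h2)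
  simp only [LinearMap.trace_eq_sum_inner _ b, ContinuousLinearMap.coe_coe, h]

theorem fderiv_apply_gradient {ι : Type*} [Fintype ι] (b : OrthonormalBasis ι ℝ E) (f h : E → ℝ)
    (x : E) : fderiv ℝ h x (∇ f x) = ∑ i, fderiv ℝ f x (b i) * fderiv ℝ h x (b i) := by
  conv_lhs => rw [← b.sum_repr' (∇ f x)]
  simp only [map_sum, map_smul, smul_eq_mul]
  refine Finset.sum_congr rfl fun i _ => ?_
  rw [real_inner_comm, inner_gradient_left]

end WarpedCoordinates

/-! ### The expression of a Riemannian metric in a chart -/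

section Charts

variable {E : Type*} [NormedAddCommGroup E] [NormedSpace ℝ E]
  {H : Type*} [TopologicalSpace H] {I : ModelWithCorners ℝ E H}
  {M : Type*} [TopologicalSpace M] [ChartedSpace H M] [IsManifold I ∞ M]

theorem metricInChart_symm (g : RiemMetric I M) (x : M) (y v w : E) :
    metricInChart g x y v w = metricInChart g x y w v := by
  rw [metricInChart_apply, metricInChart_apply, g.symm]

/-- The chart around `x` has the identity as derivative at `x`, so `ricci` needs no change of
tangent vectors. -/
theorem ricci_eq_coordRicci (g : RiemMetric I M) (x : M) (v w : E) :
    ricci g x v w = coordRicci (metricInChart g x) (extChartAt I x x) v w := by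
  have : IsManifold I 1 M := .of_le (n := ∞) (by simp)
  have hT : ∀ u : E, mfderiv I 𝓘(ℝ, E) (extChartAt I x) x u = u := fun u =>
    congrArg (fun L : E →L[ℝ] E => L u) (mfderiv_extChartAt_self (I := I) (x := x))
  exact congrArg₂ (coordRicci (metricInChart g x) (extChartAt I x x)) (hT v) (hT w)

theorem hessian_eq_coordHessian (g : RiemMetric I M) (φ : M → ℝ) (x : M) (v w : E) :
    hessian g φ x v w =
      coordHessian (metricInChart g x) (φ ∘ (extChartAt I x).symm) (extChartAt I x x) v w := by
  have : IsManifold I 1 M := .of_le (n := ∞) (by simp)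
  have hT : ∀ u : E, mfderiv I 𝓘(ℝ, E) (extChartAt I x) x u = u := fun u =>
    congrArg (fun L : E →L[ℝ] E => L u) (mfderiv_extChartAt_self (I := I) (x := x))
  exact congrArg₂ _ (hT v) (hT w)

variable [I.Boundaryless]

theorem mdifferentiableAt_extChartAt_symm_of_boundaryless {x : M} {y : E}
    (hy : y ∈ (extChartAt I x).target) :
    MDifferentiableAt 𝓘(ℝ, E) I (extChartAt I x).symm y := by
  have : IsManifold I 1 M := .of_le (n := ∞) (by simp)
  have h := mdifferentiableWithinAt_extChartAt_symm hy
  rwa [I.range_eq_univ, mdifferentiableWithinAt_univ] at h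

theorem metricInChart_pos (g : RiemMetric I M) {x : M} {y : E}
    (hy : y ∈ (extChartAt I x).target) (v : E) (hv : v ≠ 0) : 0 < metricInChart g x y v v := by
  have : IsManifold I 1 M := .of_le (n := ∞) (by simp)
  rw [metricInChart_apply]
  refine g.pos _ _ fun h0 => hv ?_
  have h := isInvertible_mfderivWithin_extChartAt_symm (I := I) hy
  rw [I.range_eq_univ, mfderivWithin_univ] at h
  obtain ⟨L, hL⟩ := h
  have h1 : L v = 0 := by
    rw [← h0, ← hL]
    rfl
  exact L.map_eq_zero_iff.1 h1

theorem metricInChart_self (g : RiemMetric I M) (x : M) (v w : E) :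
    metricInChart g x (extChartAt I x x) v w = g.inner x v w := by
  have : IsManifold I 1 M := .of_le (n := ∞) (by simp)
  have h := mfderivWithin_range_extChartAt_symm (I := I) (x := x)
  rw [I.range_eq_univ, mfderivWithin_univ] at h
  have hT : ∀ u : E, mfderiv 𝓘(ℝ, E) I (extChartAt I x).symm (extChartAt I x x) u = u := fun u =>
    congrArg (fun L : E →L[ℝ] E => L u) h
  -- The base point `φ⁻¹ (φ x)` is only propositionally `x`, and the fibers depend on it.
  have key : ∀ x' : M, x' = x → ∀ a b : E, a = v → b = w →
      (show E →L[ℝ] E →L[ℝ] ℝ from g.inner x') a b = (show E →L[ℝ] E →L[ℝ] ℝ from g.inner x) v w := by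
    rintro x' rfl a b rfl rfl
    rfl
  exact key _ (extChartAt_to_inv x) _ _ (hT v) (hT w)

/-- The coordinate vector fields of a chart are smooth. -/
theorem contMDiffAt_mfderiv_extChartAt_symm {x : M} {y : E} (hy : y ∈ (extChartAt I x).target)
    (v : E) : ContMDiffAt 𝓘(ℝ, E) (I.prod 𝓘(ℝ, E)) ∞
      (fun z => (⟨(extChartAt I x).symm z, mfderiv 𝓘(ℝ, E) I (extChartAt I x).symm z v⟩ :
        TangentBundle I M)) y := by
  have : IsManifold I 1 M := .of_le (n := ∞) (by simp)
  have hopen : IsOpen (extChartAt I x).target := isOpen_extChartAt_target x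
  have hs : ContMDiffOn 𝓘(ℝ, E) I ∞ (extChartAt I x).symm (extChartAt I x).target :=
    contMDiffOn_extChartAt_symm x
  have hT := hs.contMDiffOn_tangentMapWithin (m := ∞) (by simp) hopen.uniqueMDiffOn
  have hsec : ContMDiff 𝓘(ℝ, E) (𝓘(ℝ, E).prod 𝓘(ℝ, E)) ∞
      (fun z : E => (⟨z, v⟩ : TangentBundle 𝓘(ℝ, E) E)) := by
    intro z
    rw [Bundle.contMDiffAt_totalSpace]
    refine ⟨contMDiffAt_id, ?_⟩
    simpa using! contMDiffAt_const
  have hc := hT.comp hsec.contMDiffOn (s := (extChartAt I x).target) fun z hz => hz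
  refine (hc.contMDiffAt (hopen.mem_nhds hy)).congr_of_eventuallyEq ?_
  filter_upwards [hopen.mem_nhds hy] with z hz
  simp only [Function.comp_apply, tangentMapWithin]
  rw [mfderivWithin_of_mem_nhds (hopen.mem_nhds hz)]

theorem contDiffAt_metricInChart [FiniteDimensional ℝ E] (g : RiemMetric I M) {x : M} {y : E}
    (hy : y ∈ (extChartAt I x).target) : ContDiffAt ℝ ∞ (metricInChart g x) y := by
  refine .of_clm_apply fun v => .of_clm_apply fun w => ?_
  have hs : ContMDiffAt 𝓘(ℝ, E) I ∞ (extChartAt I x).symm y :=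
    (contMDiffOn_extChartAt_symm x).contMDiffAt ((isOpen_extChartAt_target x).mem_nhds hy)
  exact (contMDiffAt_metric_apply g hs (contMDiffAt_mfderiv_extChartAt_symm hy v)
    (contMDiffAt_mfderiv_extChartAt_symm hy w)).contDiffAt

end Charts

section WarpedCharts

variable {E : Type*} [NormedAddCommGroup E] [InnerProductSpace ℝ E] [FiniteDimensional ℝ E]
  {E' : Type*} [NormedAddCommGroup E'] [NormedSpace ℝ E'] [FiniteDimensional ℝ E']
  {H' : Type*} [TopologicalSpace H'] {J : ModelWithCorners ℝ E' H'} [J.Boundaryless]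
  {F : Type*} [TopologicalSpace F] [ChartedSpace H' F] [IsManifold J ∞ F]

/-- In a product chart, a warped product over a flat base is `⟨·, ·⟩ ⊕ f² G`, with `G` the
expression of the metric of the fiber in its chart. -/
theorem metricInChart_warpedProduct {gB : RiemMetric 𝓘(ℝ, E) E}
    (hgB : ∀ x v w : E, gB.inner x v w = inner ℝ v w) (gF : RiemMetric J F) {f : E → ℝ}
    (hf : ContMDiff 𝓘(ℝ, E) 𝓘(ℝ) ∞ f) (hpos : ∀ x, 0 < f x) (x : E × F) {p : E × E'}
    (hp : p.2 ∈ (extChartAt J x.2).target) :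
    metricInChart (warpedProduct gB gF f hf hpos) x p =
      warpedForm f (metricInChart gF x.2) p := by
  have : IsManifold J 1 F := .of_le (n := ∞) (by simp)
  have : IsManifold (𝓘(ℝ, E).prod J) 1 (E × F) := .of_le (n := ∞) (by simp)
  have hchart : extChartAt (𝓘(ℝ, E).prod J) x =
      (PartialEquiv.refl E).prod (extChartAt J x.2) := by
    rw [extChartAt_prod, extChartAt_model_space_eq_id]
  have hsymm : ∀ q : E × E', (extChartAt (𝓘(ℝ, E).prod J) x).symm q =
      (q.1, (extChartAt J x.2).symm q.2) := fun q => by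
    rw [hchart]
    rfl
  have hpt : p ∈ (extChartAt (𝓘(ℝ, E).prod J) x).target := by
    rw [hchart]
    exact ⟨trivial, hp⟩
  have hT := mdifferentiableAt_extChartAt_symm_of_boundaryless hpt
  have hTF := mdifferentiableAt_extChartAt_symm_of_boundaryless hp
  have h1 : ∀ v : E × E', mfderiv (𝓘(ℝ, E).prod J) 𝓘(ℝ, E) (Prod.fst : E × F → E)
      ((extChartAt (𝓘(ℝ, E).prod J) x).symm p)
      (mfderiv 𝓘(ℝ, E × E') (𝓘(ℝ, E).prod J) (extChartAt (𝓘(ℝ, E).prod J) x).symm p v) = v.1 := by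
    intro v
    rw [← mfderiv_comp_apply p mdifferentiableAt_fst hT v]
    have : (Prod.fst : E × F → E) ∘ (extChartAt (𝓘(ℝ, E).prod J) x).symm = Prod.fst :=
      funext fun q => by rw [Function.comp_apply, hsymm]
    rw [this, mfderiv_eq_fderiv, fderiv_fst]
    rfl
  have h2 : ∀ v : E × E', mfderiv (𝓘(ℝ, E).prod J) J (Prod.snd : E × F → F)
      ((extChartAt (𝓘(ℝ, E).prod J) x).symm p)
      (mfderiv 𝓘(ℝ, E × E') (𝓘(ℝ, E).prod J) (extChartAt (𝓘(ℝ, E).prod J) x).symm p v) =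
      mfderiv 𝓘(ℝ, E') J (extChartAt J x.2).symm p.2 v.2 := by
    intro v
    rw [← mfderiv_comp_apply p mdifferentiableAt_snd hT v]
    have : (Prod.snd : E × F → F) ∘ (extChartAt (𝓘(ℝ, E).prod J) x).symm =
        (extChartAt J x.2).symm ∘ (Prod.snd : E × E' → E') :=
      funext fun q => by rw [Function.comp_apply, hsymm, Function.comp_apply]
    rw [this, mfderiv_comp p hTF differentiableAt_snd.mdifferentiableAt,
      mfderiv_eq_fderiv, fderiv_snd]
    rfl
  have hfst : ((extChartAt (𝓘(ℝ, E).prod J) x).symm p).1 = p.1 := by rw [hsymm]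
  have hsnd : ((extChartAt (𝓘(ℝ, E).prod J) x).symm p).2 = (extChartAt J x.2).symm p.2 := by
    rw [hsymm]
  -- The tangent spaces sit over base points that are only propositionally equal, so the metrics
  -- are compared after generalizing points and vectors.
  have keyB : ∀ a b v w : E, a = v → b = w → ∀ z : E,
      gB.inner z a b = inner ℝ v w := by
    rintro a b _ _ rfl rfl z
    exact hgB z a b
  have keyF : ∀ z z' : F, z = z' → ∀ a b v w : E', a = v → b = w →
      gF.inner z a b = gF.inner z' v w := by
    rintro z _ rfl a b _ _ rfl rfl
    rfl
  refine ContinuousLinearMap.ext fun v => ContinuousLinearMap.ext fun w => ?_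
  rw [metricInChart_apply, warpedForm_apply, metricInChart_apply]
  refine (warpedInner_apply gB gF f _ _ _).trans (congrArg₂ (· + ·) ?_ (congrArg₂ (· * ·) ?_ ?_))
  · exact keyB _ _ _ _ (h1 v) (h1 w) _
  · rw [hfst]
  · exact keyF _ _ hsnd _ _ _ _ (h2 v) (h2 w)

end WarpedCharts

/-! ### Ricci tensor and Hessian of a warped product over a flat base -/

section WarpedProduct

variable {E : Type*} [NormedAddCommGroup E] [InnerProductSpace ℝ E]
  {E' : Type*} [NormedAddCommGroup E'] [NormedSpace ℝ E']
  {H' : Type*} [TopologicalSpace H'] {J : ModelWithCorners ℝ E' H'}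
  {F : Type*} [TopologicalSpace F] [ChartedSpace H' F]

theorem extChartAt_prod_vectorSpace (x y : E × F) :
    extChartAt (𝓘(ℝ, E).prod J) x y = (y.1, extChartAt J x.2 y.2) := by
  rw [extChartAt_prod, extChartAt_model_space_eq_id]
  rfl

theorem extChartAt_symm_prod_vectorSpace (x : E × F) (p : E × E') :
    (extChartAt (𝓘(ℝ, E).prod J) x).symm p = (p.1, (extChartAt J x.2).symm p.2) := by
  rw [extChartAt_prod, extChartAt_model_space_eq_id]
  rfl

variable [FiniteDimensional ℝ E] [FiniteDimensional ℝ E'] [IsManifold J ∞ F]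
  {gB : RiemMetric 𝓘(ℝ, E) E} {f : E → ℝ}

theorem warpedProduct_inner (hgB : ∀ x v w : E, gB.inner x v w = inner ℝ v w)
    (gF : RiemMetric J F) (hf : ContDiff ℝ ∞ f) (hpos : ∀ x, 0 < f x) (x : E × F)
    (v w : E × E') :
    (warpedProduct gB gF f hf.contMDiff hpos).inner x v w =
      inner ℝ v.1 w.1 + (f x.1) ^ 2 * gF.inner x.2 v.2 w.2 := by
  refine (warpedInner_apply gB gF f x v w).trans ?_
  rw [mfderiv_fst, mfderiv_snd]
  exact congrArg (· + _) (hgB x.1 v.1 w.1)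

variable [J.Boundaryless]

theorem metricInChart_warpedProduct_eventuallyEq
    (hgB : ∀ x v w : E, gB.inner x v w = inner ℝ v w) (gF : RiemMetric J F)
    (hf : ContDiff ℝ ∞ f) (hpos : ∀ x, 0 < f x) (x : E × F) :
    metricInChart (warpedProduct gB gF f hf.contMDiff hpos) x
      =ᶠ[𝓝 ((x.1, extChartAt J x.2 x.2) : E × E')] warpedForm f (metricInChart gF x.2) := by
  filter_upwards [continuousAt_snd.eventually (extChartAt_target_mem_nhds (I := J) x.2)] with p hp
  exact metricInChart_warpedProduct hgB gF hf.contMDiff hpos x hp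

/-- O'Neill's formula: `Ric = Ric_F - (m / f) Hess f - (f Δf + (m - 1) |∇f|²) g_F`, where
`m = dim F` and the Laplacian is the trace of the derivative of the gradient. -/
theorem ricci_warpedProduct (hgB : ∀ x v w : E, gB.inner x v w = inner ℝ v w)
    (gF : RiemMetric J F) (hf : ContDiff ℝ ∞ f) (hpos : ∀ x, 0 < f x) (x : E × F)
    (v w : E × E') :
    ricci (warpedProduct gB gF f hf.contMDiff hpos) x v w =
      ricci gF x.2 v.2 w.2
        - Module.finrank ℝ E' * (fderiv ℝ (fderiv ℝ f) x.1 v.1 w.1 / f x.1)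
        - (f x.1 * LinearMap.trace ℝ E (fderiv ℝ (∇ f) x.1 : E →ₗ[ℝ] E)
          + (Module.finrank ℝ E' - 1) * fderiv ℝ f x.1 (∇ f x.1)) * gF.inner x.2 v.2 w.2 := by
  have ht : ∀ᶠ z in 𝓝 (extChartAt J x.2 x.2), z ∈ (extChartAt J x.2).target :=
    extChartAt_target_mem_nhds x.2
  rw [ricci_eq_coordRicci, extChartAt_prod_vectorSpace,
    coordRicci_congr (metricInChart_warpedProduct_eventuallyEq hgB gF hf hpos x),
    coordRicci_warpedForm (p := (x.1, extChartAt J x.2 x.2)) hf (fun y => (hpos y).ne')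
      (ht.mono fun z hz => contDiffAt_metricInChart gF hz)
      (.of_forall fun z => metricInChart_symm gF x.2 z)
      (ht.mono fun z hz => metricInChart_pos gF hz), metricInChart_self, ricci_eq_coordRicci]

theorem hessian_warpedProduct (hgB : ∀ x v w : E, gB.inner x v w = inner ℝ v w)
    (gF : RiemMetric J F) (hf : ContDiff ℝ ∞ f) (hpos : ∀ x, 0 < f x) {h : E → ℝ}
    (hh : ContDiff ℝ ∞ h) (x : E × F) (v w : E × E') :
    hessian (warpedProduct gB gF f hf.contMDiff hpos) (fun p => h p.1) x v w =
      fderiv ℝ (fderiv ℝ h) x.1 v.1 w.1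
        + f x.1 * fderiv ℝ h x.1 (∇ f x.1) * gF.inner x.2 v.2 w.2 := by
  have ht : extChartAt J x.2 x.2 ∈ (extChartAt J x.2).target := mem_extChartAt_target x.2
  have hcomp : (fun p : E × F => h p.1) ∘ (extChartAt (𝓘(ℝ, E).prod J) x).symm =
      fun q => h q.1 := funext fun q => by
    rw [Function.comp_apply, extChartAt_symm_prod_vectorSpace]
  rw [hessian_eq_coordHessian, hcomp, extChartAt_prod_vectorSpace,
    coordHessian_congr (metricInChart_warpedProduct_eventuallyEq hgB gF hf hpos x),
    coordHessian_warpedForm (p := (x.1, extChartAt J x.2 x.2)) hf.contDiffAt (hpos _).ne' hh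
      (contDiffAt_metricInChart gF ht) (metricInChart_pos gF ht), metricInChart_self]

/-- With an Einstein fiber the soliton equation decouples: the base block involves only second
derivatives of `f` and `h`, and the fiber block is a scalar multiple of the metric of the fiber. -/
theorem isGradientRicciSoliton_warpedProduct_iff [Nonempty F] [Nontrivial E']
    (hgB : ∀ x v w : E, gB.inner x v w = inner ℝ v w)
    {gF : RiemMetric J F} {lam : ℝ} (hF : IsEinsteinWith gF lam) (hf : ContDiff ℝ ∞ f)
    (hpos : ∀ x, 0 < f x) {h : E → ℝ} (hh : ContDiff ℝ ∞ h) (ρ : ℝ) :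
    IsGradientRicciSoliton (warpedProduct gB gF f hf.contMDiff hpos) (fun p : E × F => h p.1) ρ ↔
      (∀ x v w : E, f x * fderiv ℝ (fderiv ℝ h) x v w
        - Module.finrank ℝ E' * fderiv ℝ (fderiv ℝ f) x v w = ρ * f x * inner ℝ v w) ∧
      ∀ x : E, -(f x * LinearMap.trace ℝ E (fderiv ℝ (∇ f) x : E →ₗ[ℝ] E))
        - (Module.finrank ℝ E' - 1) * fderiv ℝ f x (∇ f x) + f x * fderiv ℝ h x (∇ f x)
          = ρ * (f x) ^ 2 - lam := by
  have hsmooth : ContMDiff (𝓘(ℝ, E).prod J) 𝓘(ℝ) ∞ (fun p : E × F => h p.1) :=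
    hh.contMDiff.comp contMDiff_fst
  -- At each point the defect of the soliton equation is a base form plus a multiple of `gF`.
  have key : ∀ (x : E × F) (v w : E × E'),
      (ricci (warpedProduct gB gF f hf.contMDiff hpos) x v w
        + hessian (warpedProduct gB gF f hf.contMDiff hpos) (fun p : E × F => h p.1) x v w
        = ρ * (warpedProduct gB gF f hf.contMDiff hpos).inner x v w) ↔
      (f x.1 * fderiv ℝ (fderiv ℝ h) x.1 v.1 w.1
        - Module.finrank ℝ E' * fderiv ℝ (fderiv ℝ f) x.1 v.1 w.1
        - ρ * f x.1 * inner ℝ v.1 w.1) / f x.1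
      + (-(f x.1 * LinearMap.trace ℝ E (fderiv ℝ (∇ f) x.1 : E →ₗ[ℝ] E))
        - (Module.finrank ℝ E' - 1) * fderiv ℝ f x.1 (∇ f x.1) + f x.1 * fderiv ℝ h x.1 (∇ f x.1)
        - (ρ * (f x.1) ^ 2 - lam)) * gF.inner x.2 v.2 w.2 = 0 := fun x v w => by
    have hfx := (hpos x.1).ne'
    have hric : ricci gF x.2 v.2 w.2 = lam * gF.inner x.2 v.2 w.2 := hF x.2 v.2 w.2
    rw [ricci_warpedProduct hgB gF hf hpos, hessian_warpedProduct hgB gF hf hpos hh,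
      warpedProduct_inner hgB gF hf hpos, hric, ← sub_eq_zero]
    refine iff_of_eq (congrArg (· = 0) ?_)
    field_simp
    ring
  constructor
  · rintro ⟨-, hsol⟩
    obtain ⟨q⟩ := ‹Nonempty F›
    -- Testing on horizontal vectors isolates the base form, on a vertical vector the scalar factor.
    refine ⟨fun x v w => ?_, fun x => ?_⟩
    · have h1 := (key (x, q) (v, 0) (w, 0)).1 (hsol _ _ _)
      have h2 : gF.inner q (0 : E') (0 : E') = 0 := (gF.inner q (0 : E')).map_zero
      rw [h2, mul_zero, add_zero, div_eq_zero_iff, or_iff_left (hpos x).ne'] at h1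
      exact sub_eq_zero.1 h1
    · obtain ⟨c, hc⟩ := exists_ne (0 : E')
      have h1 := (key (x, q) (0, c) (0, c)).1 (hsol _ _ _)
      have h2 : 0 < gF.inner q c c := gF.pos q c hc
      simp only [map_zero, mul_zero, sub_zero, zero_div, zero_add, inner_zero_left] at h1
      exact sub_eq_zero.1 ((mul_eq_zero.1 h1).resolve_right h2.ne')
  · rintro ⟨hbase, hfib⟩
    refine ⟨hsmooth, fun x v w => (key x v w).2 ?_⟩
    rw [hbase, hfib]
    simp

end WarpedProduct

/-! ### Partial derivatives in Euclidean space -/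

theorem pderiv_pderiv {n : ℕ} {f : EuclideanSpace ℝ (Fin n) → ℝ} (hf : ContDiff ℝ ∞ f)
    (i j : Fin n) (x : EuclideanSpace ℝ (Fin n)) :
    pderiv j (pderiv i f) x =
      fderiv ℝ (fderiv ℝ f) x (EuclideanSpace.single j 1) (EuclideanSpace.single i 1) := by
  have hfd : ContDiff ℝ ∞ (fderiv ℝ f) := hf.fderiv_right (by simp)
  have h : HasFDerivAt (pderiv i f) _ x :=
    (hfd.differentiable (by simp) x).hasFDerivAt.clm_apply
      (hasFDerivAt_const (EuclideanSpace.single i (1 : ℝ)) x)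
  rw [pderiv, h.fderiv]
  simp

/-- A bilinear form on `ℝⁿ` is `c` times the inner product exactly when it is so on the standard
basis. -/
theorem bilin_eq_mul_inner_iff {n : ℕ}
    (L : EuclideanSpace ℝ (Fin n) →L[ℝ] EuclideanSpace ℝ (Fin n) →L[ℝ] ℝ) (c : ℝ) :
    (∀ v w, L v w = c * inner ℝ v w) ↔
      (∀ i j, i ≠ j → L (EuclideanSpace.single j 1) (EuclideanSpace.single i 1) = 0) ∧
        ∀ i, L (EuclideanSpace.single i 1) (EuclideanSpace.single i 1) = c := by
  constructor
  · intro h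
    refine ⟨fun i j hij => ?_, fun i => ?_⟩
    · simp [h, EuclideanSpace.inner_single_left, hij.symm]
    · simp [h]
  · rintro ⟨hne, heq⟩ v w
    have hb : ∀ u : EuclideanSpace ℝ (Fin n), u = ∑ i, u i • EuclideanSpace.single i (1 : ℝ) :=
      fun u => by simpa using ((EuclideanSpace.basisFun (Fin n) ℝ).sum_repr u).symm
    have hL : ∀ i j, L (EuclideanSpace.single j 1) (EuclideanSpace.single i 1) =
        if i = j then c else 0 := fun i j => by
      split_ifs with hij
      · rw [hij, heq]
      · exact hne i j hij
    conv_lhs => rw [hb v, hb w]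
    simp [hL, PiLp.inner_apply, Finset.mul_sum]
    exact Finset.sum_congr rfl fun i _ => by ring

end RicciSoliton

/-- Gradient Ricci solitons on warped products `ℝⁿ ×_f Fᵐ` with Einstein fiber. -/
theorem theorem2 (n m : ℕ) (hn : 2 ≤ n) (hm : 1 ≤ m)
    {F : Type*} [TopologicalSpace F] [ChartedSpace (EuclideanSpace ℝ (Fin m)) F]
    [IsManifold 𝓘(ℝ, EuclideanSpace ℝ (Fin m)) ∞ F] [Nonempty F]
    (gF : RicciSoliton.RiemMetric 𝓘(ℝ, EuclideanSpace ℝ (Fin m)) F) (lam : ℝ)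
    (hF : RicciSoliton.IsEinsteinWith gF lam)
    (f h : EuclideanSpace ℝ (Fin n) → ℝ) (hf : ContDiff ℝ ∞ f) (hh : ContDiff ℝ ∞ h)
    (hpos : ∀ x, 0 < f x) (ρ : ℝ) :
    RicciSoliton.IsGradientRicciSoliton
        (RicciSoliton.warpedProduct (RicciSoliton.euclideanMetric n) gF f hf.contMDiff hpos)
        (fun p : EuclideanSpace ℝ (Fin n) × F => h p.1) ρ ↔
      (∀ i j : Fin n, i ≠ j → ∀ x : EuclideanSpace ℝ (Fin n),
        f x * RicciSoliton.pderiv j (RicciSoliton.pderiv i h) x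
          - m * RicciSoliton.pderiv j (RicciSoliton.pderiv i f) x = 0) ∧
      (∀ (i : Fin n) (x : EuclideanSpace ℝ (Fin n)),
        f x * RicciSoliton.pderiv i (RicciSoliton.pderiv i h) x
          - m * RicciSoliton.pderiv i (RicciSoliton.pderiv i f) x = ρ * f x) ∧
      (∀ x : EuclideanSpace ℝ (Fin n),
        ∑ k : Fin n,
          (-(f x * RicciSoliton.pderiv k (RicciSoliton.pderiv k f) x)
            - ((m : ℝ) - 1) * (RicciSoliton.pderiv k f x) ^ 2
            + f x * RicciSoliton.pderiv k f x * RicciSoliton.pderiv k h x)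
          = ρ * (f x) ^ 2 - lam) := by
  have : Nonempty (Fin m) := ⟨⟨0, hm⟩⟩
  have hfin : Module.finrank ℝ (EuclideanSpace ℝ (Fin m)) = m := finrank_euclideanSpace_fin
  rw [RicciSoliton.isGradientRicciSoliton_warpedProduct_iff
    (RicciSoliton.euclideanMetric_apply n) hF hf hpos hh ρ, ← and_assoc]
  simp only [RicciSoliton.pderiv_pderiv hf, RicciSoliton.pderiv_pderiv hh, hfin]
  refine and_congr ?_ (forall_congr' fun x => ?_)
  · have hbil := fun x => RicciSoliton.bilin_eq_mul_inner_iff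
      (f x • fderiv ℝ (fderiv ℝ h) x - (m : ℝ) • fderiv ℝ (fderiv ℝ f) x) (ρ * f x)
    simp only [sub_apply, smul_apply, smul_eq_mul] at hbil
    simp only [hbil]
    exact ⟨fun H => ⟨fun i j hij x => (H x).1 i j hij, fun i x => (H x).2 i⟩,
      fun H x => ⟨fun i j hij => H.1 i j hij x, fun i => H.2 i x⟩⟩
  · rw [RicciSoliton.trace_fderiv_gradient (EuclideanSpace.basisFun (Fin n) ℝ) hf,
      RicciSoliton.fderiv_apply_gradient (EuclideanSpace.basisFun (Fin n) ℝ) f f,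
      RicciSoliton.fderiv_apply_gradient (EuclideanSpace.basisFun (Fin n) ℝ) f h]
    refine iff_of_eq (congrArg (· = _) ?_)
    simp only [EuclideanSpace.basisFun_apply, RicciSoliton.pderiv, Finset.mul_sum,
      ← Finset.sum_neg_distrib, ← Finset.sum_sub_distrib, ← Finset.sum_add_distrib]
    exact Finset.sum_congr rfl fun k _ => by ring
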